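/- Let $n \ge 1$ be an integer and $a>0$. Let $\Gamma:\mathbb{R}\to\mathbb{R}^{n+1}$ be a curve of class $C^{1,1}$ (differentiable, with locally Lipschitz derivative) parameterised by arc length, put $T:=\Gamma'$, and let $(T,N_1,\dots,N_n)$ be a relatively parallel adapted frame of $\Gamma$, i.e. an orthonormal frame along $\Gamma$ with locally Lipschitz normal fields $N_j$ such that, almost everywhere, $T'=\sum_j k_jN_j$ and $N_j'=-k_jT$; let $k:=(k_1,\dots,k_n)$. Let $\Theta:\mathbb{R}\to\mathbb{R}^n$ be locally Lipschitz with $|\Theta(s)|=1$ for all $s$, and assume that $k\cdot\Theta\in L^\infty(\mathbb{R})$ and $a\,\|k\cdot\Theta\|_{L^\infty(\mathbb{R})}<1$. Let $\Omega_0:=\mathbb{R}\times(-a,a)$ and $$f(s,t):=\sqrt{\big[1-t\,k(s)\cdot\Theta(s)\big]^2+t^2\,|\Theta'(s)|^2}\,.$$ In the complex Hilbert space $\mathcal{H}:=L^2(\Omega_0,f(s,t)\,ds\,dt)$ consider the quadratic form $$h[\psi]:=\int_{\Omega_0}\frac{|\partial_1\psi|^2}{f}\,ds\,dt+\int_{\Omega_0}|\partial_2\psi|^2\,f\,ds\,dt\,,$$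 with weak derivatives $\partial_1=\partial_s$, $\partial_2=\partial_t$, whose domain $\mathrm{Dom}(h)$ is the closure of $C_0^\infty(\Omega_0)$ in the norm $(h[\psi]+\|\psi\|_{\mathcal{H}}^2)^{1/2}$. Let $H$ be the self-adjoint operator in $\mathcal{H}$ associated with $h$ (the Dirichlet Laplacian of the strip $\{\Gamma(s)+t\sum_j\Theta_j(s)N_j(s)\}$): $\psi\in\mathrm{Dom}(H)$ and $H\psi=\eta$ if and only if $\psi\in\mathrm{Dom}(h)$, $\eta\in\mathcal{H}$ and $h(\phi,\psi)=(\phi,\eta)_{\mathcal{H}}$ for every $\phi\in\mathrm{Dom}(h)$. Let $E_1:=\big(\frac{\pi}{2a}\big)^2$ and $\rho(s,t):=\frac{1}{1+s^2}$. Suppose that $k\cdot\Theta=0$ almost everywhere, that $\Theta'$ is not almost everywhere equal to zero, and that $$a\,\|\Theta'\|_{L^\infty(\mathbb{R})}\le\sqrt{2}\,,\qquad \|\Theta'\|_{L^\infty(\mathbb{R})}:=\big\||\Theta'|\big\|_{L^\infty(\mathbb{R})}.$$ Then there exists a constant $c>0$ such that $H-E_1\ge c\,\rho$ in the sense of quadratic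 forms in $\mathcal{H}$, that is, $$h[\psi]-E_1\,\|\psi\|_{\mathcal{H}}^2\ \ge\ c\int_{\Omega_0}\frac{|\psi(s,t)|^2}{1+s^2}\,f(s,t)\,ds\,dt\qquad\text{for every }\psi\in\mathrm{Dom}(h)\,;$$ in particular $(\psi,H\psi)_{\mathcal{H}}-E_1\|\psi\|_{\mathcal{H}}^2\ge c\,\|\rho^{1/2}\psi\|_{\mathcal{H}}^2$ for every $\psi\in\mathrm{Dom}(H)$. -/

import Mathlib

open MeasureTheory Filter Topology
open scoped ENNReal ContDiff RealInnerProductSpace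

noncomputable section

/-- The data of a strip in `ℝ^(n+1)`: the half-width `a`, the reference curve `Γ`, the normal
fields `N 0, …, N (n-1)` along `Γ` and the twisting vector `Θ`. -/
structure Strip (n : ℕ) where
  a : ℝ
  Γ : ℝ → EuclideanSpace ℝ (Fin (n + 1))
  N : Fin n → ℝ → EuclideanSpace ℝ (Fin (n + 1))
  Θ : ℝ → EuclideanSpace ℝ (Fin n)

namespace Strip

variable {n : ℕ} (S : Strip n)

/-- The tangent field `T = Γ'`. -/
def T (s : ℝ) : EuclideanSpace ℝ (Fin (n + 1)) := deriv S.Γ s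

/-- The curvature vector `k`; its components are `k_j = T' · N_j` (defined almost everywhere). -/
def k (s : ℝ) : EuclideanSpace ℝ (Fin n) :=
  WithLp.toLp 2 fun j => ⟪deriv S.T s, S.N j s⟫

/-- The geodesic curvature `k · Θ` of `Γ` as a curve on the strip. -/
def kΘ (s : ℝ) : ℝ := ⟪S.k s, S.Θ s⟫

/-- `Γ` is a curve of class `C^{1,1}` (the derivative is locally Lipschitz), parameterised by
arc length. -/
structure IsUnitSpeedC11 : Prop where
  differentiable : Differentiable ℝ S.Γ
  locallyLipschitz : LocallyLipschitz S.T
  unit_speed : ∀ s, ‖S.T s‖ = 1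

/-- `(T, N_1, …, N_n)` is a relatively parallel adapted frame of `Γ`: it is orthonormal, the
normal fields are locally Lipschitz, and `T' = ∑ k_j N_j`, `N_j' = - k_j T`. -/
structure IsRelativelyParallelFrame : Prop where
  orthonormal : ∀ s, Orthonormal ℝ
    (Fin.cons (S.T s) (fun j => S.N j s) : Fin (n + 1) → EuclideanSpace ℝ (Fin (n + 1)))
  locallyLipschitz : ∀ j, LocallyLipschitz (S.N j)
  deriv_T : ∀ᵐ s : ℝ, deriv S.T s = ∑ j, S.k s j • S.N j s
  deriv_N : ∀ j, ∀ᵐ s : ℝ, deriv (S.N j) s = -(S.k s j • S.T s)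

/-- The standing assumptions on the strip: `a > 0`, `Γ` is of class `C^{1,1}` with a relatively
parallel adapted frame, `Θ` is of class `C^{0,1}` (locally Lipschitz) with `|Θ| = 1`,
`k · Θ ∈ L^∞` and `a ‖k · Θ‖_∞ < 1`. -/
structure Admissible : Prop where
  a_pos : 0 < S.a
  curve : S.IsUnitSpeedC11
  frame : S.IsRelativelyParallelFrame
  twist_locallyLipschitz : LocallyLipschitz S.Θ
  twist_unit : ∀ s, ‖S.Θ s‖ = 1
  kΘ_memLp : MemLp S.kΘ ∞ volume
  kΘ_lt : ENNReal.ofReal S.a * eLpNorm S.kΘ ∞ volume < 1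

/-- The straight strip `Ω₀ = ℝ × (-a, a)`. -/
def Ω₀ : Set (ℝ × ℝ) := Set.univ ×ˢ Set.Ioo (-S.a) S.a

/-- The Jacobian `f(s,t) = √((1 - t (k · Θ)(s))² + t² |Θ'(s)|²)` of the metric
`g = diag(f², 1)` of the strip. -/
def f (x : ℝ × ℝ) : ℝ :=
  √((1 - x.2 * S.kΘ x.1) ^ 2 + x.2 ^ 2 * ‖deriv S.Θ x.1‖ ^ 2)

/-- The Riemannian measure `f(s,t) ds dt` on `Ω₀`. -/
def stripMeasure : Measure (ℝ × ℝ) :=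
  (volume.restrict S.Ω₀).withDensity fun x => ENNReal.ofReal (S.f x)

/-- The complex Hilbert space `ℋ = L²(Ω₀, f(s,t) ds dt)`. -/
abbrev HilbertSpace : Type := Lp ℂ 2 S.stripMeasure

/-- `C_0^∞(Ω₀)`. -/
structure IsTest (φ : ℝ × ℝ → ℂ) : Prop where
  contDiff : ContDiff ℝ ∞ φ
  hasCompactSupport : HasCompactSupport φ
  tsupport_subset : tsupport φ ⊆ S.Ω₀

/-- `u` is the weak derivative of `ψ` in `Ω₀` in the direction `e`. -/
structure IsWeakDeriv (e : ℝ × ℝ) (ψ u : ℝ × ℝ → ℂ) : Prop where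
  locallyIntegrableOn : LocallyIntegrableOn ψ S.Ω₀ volume
  locallyIntegrableOn_deriv : LocallyIntegrableOn u S.Ω₀ volume
  integral_eq : ∀ φ, S.IsTest φ →
    ∫ x in S.Ω₀, ψ x * fderiv ℝ φ x e = - ∫ x in S.Ω₀, u x * φ x

/-- The weak derivative of `ψ` in `Ω₀` in the direction `e` (unique up to null sets of `Ω₀`; zero
if there is none). -/
def weakDeriv (e : ℝ × ℝ) (ψ : ℝ × ℝ → ℂ) : ℝ × ℝ → ℂ :=
  open Classical in
  if h : ∃ u, S.IsWeakDeriv e ψ u then h.choose else 0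

/-- The weak derivative `∂₁ψ` with respect to `s`. -/
def partial₁ (ψ : ℝ × ℝ → ℂ) : ℝ × ℝ → ℂ := S.weakDeriv (1, 0) ψ

/-- The weak derivative `∂₂ψ` with respect to `t`. -/
def partial₂ (ψ : ℝ × ℝ → ℂ) : ℝ × ℝ → ℂ := S.weakDeriv (0, 1) ψ

/-- The square of the distance of `φ ∈ C_0^∞(Ω₀)` to `ψ` in the norm
`‖ψ‖_{ℋ₁} = √(h[ψ] + ‖ψ‖²)`. -/
def distSq (φ ψ : ℝ × ℝ → ℂ) : ℝ≥0∞ :=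
  (∫⁻ x in S.Ω₀, ‖fderiv ℝ φ x (1, 0) - S.partial₁ ψ x‖ₑ ^ 2 / ENNReal.ofReal (S.f x))
  + (∫⁻ x in S.Ω₀, ‖fderiv ℝ φ x (0, 1) - S.partial₂ ψ x‖ₑ ^ 2 * ENNReal.ofReal (S.f x))
  + (∫⁻ x in S.Ω₀, ‖φ x - ψ x‖ₑ ^ 2 * ENNReal.ofReal (S.f x))

/-- The form domain `Dom(h)`: the closure of `C_0^∞(Ω₀)` in the norm `‖·‖_{ℋ₁}`, that is, the
`ψ ∈ ℋ` with weak first derivatives which are limits in `‖·‖_{ℋ₁}` of functions of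
`C_0^∞(Ω₀)`. -/
def formDomain : Set S.HilbertSpace :=
  {ψ | (∃ u, S.IsWeakDeriv (1, 0) ψ u) ∧ (∃ v, S.IsWeakDeriv (0, 1) ψ v) ∧
    ∃ φ : ℕ → ℝ × ℝ → ℂ, (∀ m, S.IsTest (φ m)) ∧
      Tendsto (fun m => S.distSq (φ m) ψ) atTop (𝓝 0)}

/-- The quadratic form `h[ψ] = ∫ |∂₁ψ|² / f + ∫ |∂₂ψ|² f`. -/
def form (ψ : S.HilbertSpace) : ℝ :=
  (∫ x in S.Ω₀, ‖S.partial₁ ψ x‖ ^ 2 / S.f x) + ∫ x in S.Ω₀, ‖S.partial₂ ψ x‖ ^ 2 * S.f x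

/-- The sesquilinear form `h(φ, ψ)` of the quadratic form `h`. -/
def sesqForm (φ ψ : S.HilbertSpace) : ℂ :=
  (∫ x in S.Ω₀, star (S.partial₁ φ x) * S.partial₁ ψ x / (S.f x : ℂ))
  + ∫ x in S.Ω₀, star (S.partial₂ φ x) * S.partial₂ ψ x * (S.f x : ℂ)

/-- The Hamiltonian `H` (given by its graph): the operator in `ℋ` associated with `h` by the
representation theorem. `ψ ∈ Dom(H)` and `Hψ = η` mean that `ψ ∈ Dom(h)` and
`h(φ, ψ) = (φ, η)` for every `φ ∈ Dom(h)`. -/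
def hamiltonianGraph : Set (S.HilbertSpace × S.HilbertSpace) :=
  {p | p.1 ∈ S.formDomain ∧ ∀ φ ∈ S.formDomain, S.sesqForm φ p.1 = inner ℂ φ p.2}

/-- The spectral threshold `E₁ = (π / (2a))²` of the straight strip. -/
def E₁ : ℝ := (Real.pi / (2 * S.a)) ^ 2

/-- The Hardy weight `ρ(s,t) = 1 / (1 + s²)`. -/
def hardyWeight (x : ℝ × ℝ) : ℝ := 1 / (1 + x.1 ^ 2)

/-- `‖ρ^{1/2} ψ‖²` in `ℋ`. -/
def hardyTerm (ψ : S.HilbertSpace) : ℝ :=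
  ∫ x, hardyWeight x * ‖ψ x‖ ^ 2 ∂S.stripMeasure

end Strip

end

/-!
The proof rests on two one-dimensional inequalities of Picone type. If `F` is absolutely continuous
and satisfies the Riccati inequality `F' + F² / p ≤ -q`, then `∫ q |u|² ≤ ∫ p |u'|²` for every
compactly supported `u`, because the nonnegative function `p |u' - (F / p) u|²` differs from
`p |u'|² + (F' + F² / p) |u|²` by the total derivative of `F |u|²`
(`Strip.integral_mul_norm_sq_le_of_riccati`).

Since `k · Θ = 0`, the Jacobian is `√(1 + t² κ(s)²)` with `κ = |Θ'|`, and `a κ ≤ √2` bounds it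
between `1` and `2`. On a cross-section, the lowest mode `cos (w t)`, `w = π / (2 a)`, of the
straight strip is already a super-solution at energy `w²`, as the weight increases with `|t|` while
the mode decreases. When `κ ≠ 0` it is a strict one away from `t = 0`, which leaves room for the
factor `exp (-κ² t² / 12)`: the transverse energy is at least `w² + κ² / 9`
(`Strip.integral_transverse_le`).

On each longitudinal line there remains the energy of `-d²/ds²` with the nonnegative potential
`κ²`, up to constants. It is not almost everywhere zero, and this suffices for a Hardy inequality
with weight `1 / (1 + s²)` (`Strip.exists_hardy_line`). Fubini's theorem combines both inequalities
for test functions (`Strip.exists_hardy_test`); all terms are squares of weighted `L²` norms which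
are continuous for the form norm, so the inequality passes to the form domain
(`Strip.hardy_formDomain`), and `h(ψ, ψ) = h[ψ]` gives the statement on the operator domain.
-/

namespace Strip

/-! ### Hardy-type inequalities on the line -/

section Line

variable {E : Type*} [NormedAddCommGroup E] [InnerProductSpace ℝ E]

/-- Picone's inequality with an absolutely continuous sub-solution: completing the square in
`p ‖u' - (F / p) u‖² ≥ 0` leaves the total derivative of `F ‖u‖²`, which integrates to zero. -/
theorem integral_mul_norm_sq_le_of_riccati {u : ℝ → E} (hu : ContDiff ℝ 1 u) {α β : ℝ}
    (hαβ : α < β) (hsupp : tsupport u ⊆ Set.Ioo α β) {p q F D : ℝ → ℝ}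
    (hF : AbsolutelyContinuousOnInterval F α β)
    (hD : ∀ᵐ x, x ∈ Set.Ioo α β → HasDerivAt F (D x) x)
    (hp : ∀ x, 0 < p x)
    (hric : ∀ᵐ x, x ∈ Set.Ioo α β → D x + F x ^ 2 / p x ≤ -q x)
    (hpi : Integrable fun x => p x * ‖deriv u x‖ ^ 2)
    (hqi : Integrable fun x => q x * ‖u x‖ ^ 2) :
    ∫ x, q x * ‖u x‖ ^ 2 ≤ ∫ x, p x * ‖deriv u x‖ ^ 2 := by
  have hu0 : ∀ x, x ∉ Set.Ioo α β → u x = 0 := fun x hx =>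
    image_eq_zero_of_notMem_tsupport fun h => hx (hsupp h)
  have hdu0 : ∀ x, x ∉ Set.Ioo α β → deriv u x = 0 := fun x hx => by
    by_contra hne
    exact hx (hsupp (support_deriv_subset (f := u) hne))
  have hv : ContDiff ℝ 1 fun x => ‖u x‖ ^ 2 := hu.norm_sq ℝ
  have hG := hF.mul (hv.contDiffOn.absolutelyContinuousOnInterval (a := α) (b := β))
  have hG0 := hG.integral_deriv_eq_sub
  simp only [Pi.mul_apply, hu0 α (by simp), hu0 β (by simp), norm_zero] at hG0
  have hdiff : 0 ≤ ∫ x, (p x * ‖deriv u x‖ ^ 2 - q x * ‖u x‖ ^ 2) := by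
    have hset : ∫ x, (p x * ‖deriv u x‖ ^ 2 - q x * ‖u x‖ ^ 2)
        = ∫ x in α..β, (p x * ‖deriv u x‖ ^ 2 - q x * ‖u x‖ ^ 2) := by
      rw [intervalIntegral.integral_of_le hαβ.le, integral_Ioc_eq_integral_Ioo,
        setIntegral_eq_integral_of_forall_compl_eq_zero]
      intro x hx
      simp [hu0 x hx, hdu0 x hx]
    have h0 : (0 : ℝ) = ∫ x in α..β,
        deriv (F * fun x => ‖u x‖ ^ 2) x := by rw [hG0]; simp
    rw [hset, h0]
    refine intervalIntegral.integral_mono_ae_restrict hαβ.le hG.intervalIntegrable_deriv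
      (hpi.sub hqi).intervalIntegrable ?_
    rw [← restrict_Ioo_eq_restrict_Icc]
    filter_upwards [ae_restrict_of_ae hD, ae_restrict_of_ae hric,
      ae_restrict_mem measurableSet_Ioo] with x h1 h2 hx
    have hux : HasDerivAt u (deriv u x) x := (hu.differentiable one_ne_zero x).hasDerivAt
    have hd := ((h1 hx).mul hux.norm_sq).deriv
    rw [hd]
    have hr := mul_le_mul_of_nonneg_right (h2 hx) (sq_nonneg ‖u x‖)
    have hcs := abs_real_inner_le_norm (u x) (deriv u x)
    have h3 := mul_nonneg (abs_nonneg (F x)) (sub_nonneg.2 hcs)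
    have h4 : F x * ⟪u x, deriv u x⟫ ≤ |F x| * |⟪u x, deriv u x⟫| := by
      rw [← abs_mul]; exact le_abs_self _
    have h5 : 0 ≤ (p x * ‖deriv u x‖ - |F x| * ‖u x‖) ^ 2 / p x :=
      div_nonneg (sq_nonneg _) (hp x).le
    have h6 : (p x * ‖deriv u x‖ - |F x| * ‖u x‖) ^ 2 / p x
        = p x * ‖deriv u x‖ ^ 2 - 2 * (|F x| * (‖u x‖ * ‖deriv u x‖))
          + F x ^ 2 / p x * ‖u x‖ ^ 2 := by
      rw [← sq_abs (F x)]
      field_simp [(hp x).ne']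
      ring
    nlinarith
  rw [integral_sub hpi hqi] at hdiff
  linarith

/-- The lowest transverse mode `cos(wt)` of the flat cross-section, damped by a Gaussian
`exp(-κ² t² / 12)`, is a positive super-solution of the transverse problem for the energy
`w² + κ² / 9`. The function `F` is the weight times the logarithmic derivative of that product. -/
theorem integral_transverse_le {a κ : ℝ} (ha : 0 < a) (hκ : κ ^ 2 * a ^ 2 ≤ 2) {u : ℝ → E}
    (hu : ContDiff ℝ 1 u) (hc : HasCompactSupport u) (hsupp : tsupport u ⊆ Set.Ioo (-a) a) :
    ∫ t, ((Real.pi / (2 * a)) ^ 2 + κ ^ 2 / 9) * √(1 + t ^ 2 * κ ^ 2) * ‖u t‖ ^ 2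
      ≤ ∫ t, √(1 + t ^ 2 * κ ^ 2) * ‖deriv u t‖ ^ 2 := by
  obtain ⟨b, hb0, hba, hsb⟩ : ∃ b, 0 < b ∧ b < a ∧ tsupport u ⊆ Set.Ioo (-b) b := by
    rcases (tsupport u).eq_empty_or_nonempty with h | h
    · exact ⟨a / 2, by linarith, by linarith, by simp [h]⟩
    obtain ⟨x, hx, hmax⟩ := hc.isCompact.exists_isMaxOn h continuous_abs.continuousOn
    have hxa : |x| < a := abs_lt.2 (hsupp hx)
    refine ⟨(|x| + a) / 2, by positivity, by linarith, fun y hy => ?_⟩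
    have : |y| ≤ |x| := hmax hy
    exact abs_lt.1 (by linarith)
  set w : ℝ := Real.pi / (2 * a) with hw
  have hw0 : 0 < w := by positivity
  have hwa : w * a = Real.pi / 2 := by rw [hw]; field_simp
  have hwt : ∀ t ∈ Set.Icc (-b) b, w * t ∈ Set.Ioo (-(Real.pi / 2)) (Real.pi / 2) := by
    intro t ht
    rw [← hwa]
    constructor <;> nlinarith [ht.1, ht.2]
  have hcos : ∀ t ∈ Set.Icc (-b) b, Real.cos (w * t) ≠ 0 := fun t ht =>
    (Real.cos_pos_of_mem_Ioo (hwt t ht)).ne'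
  have hpos : ∀ t : ℝ, 0 < 1 + t ^ 2 * κ ^ 2 := fun t => by positivity
  have hcont : Continuous fun t : ℝ => √(1 + t ^ 2 * κ ^ 2) := by fun_prop
  set θ : ℝ → ℝ := fun t => -w * Real.tan (w * t) - κ ^ 2 / 6 * t with hθ
  refine integral_mul_norm_sq_le_of_riccati hu (by linarith : -b < b) hsb
    (F := fun t => √(1 + t ^ 2 * κ ^ 2) * θ t)
    (D := fun t => (t * κ ^ 2 / √(1 + t ^ 2 * κ ^ 2)) * θ t
      + √(1 + t ^ 2 * κ ^ 2) * (-w ^ 2 * (1 + Real.tan (w * t) ^ 2) - κ ^ 2 / 6)) ?_ ?_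
    (fun t => Real.sqrt_pos.2 (hpos t)) ?_ ?_ ?_
  · refine ContDiffOn.absolutelyContinuousOnInterval ?_
    rw [Set.uIcc_of_le (by linarith)]
    intro t ht
    have h1 : ContDiffAt ℝ 1 (fun t : ℝ => √(1 + t ^ 2 * κ ^ 2)) t :=
      ContDiffAt.sqrt (by fun_prop) (hpos t).ne'
    have h2 : ContDiffAt ℝ 1 (fun t : ℝ => Real.tan (w * t)) t :=
      (Real.contDiffAt_tan.2 (hcos t ht)).comp t (by fun_prop)
    exact (h1.mul ((contDiffAt_const.mul h2).sub (by fun_prop))).contDiffWithinAt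
  · refine Eventually.of_forall fun t ht => ?_
    have hct := hcos t (Set.Ioo_subset_Icc_self ht)
    have h1 : HasDerivAt (fun t : ℝ => √(1 + t ^ 2 * κ ^ 2))
        (t * κ ^ 2 / √(1 + t ^ 2 * κ ^ 2)) t := by
      refine ((((hasDerivAt_pow 2 t).mul_const (κ ^ 2)).const_add 1).sqrt
        (hpos t).ne').congr_deriv ?_
      push_cast
      ring
    have h2 : HasDerivAt (fun t : ℝ => Real.tan (w * t))
        ((1 + Real.tan (w * t) ^ 2) * w) t := by
      refine ((Real.hasDerivAt_tan hct).comp t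
        ((hasDerivAt_id t).const_mul w)).congr_deriv ?_
      rw [Real.tan_eq_sin_div_cos, div_pow]
      field_simp
      rw [Real.cos_sq_add_sin_sq]
    have h3 := h1.mul ((h2.const_mul (-w)).sub ((hasDerivAt_id t).const_mul (κ ^ 2 / 6)))
    refine h3.congr_deriv ?_
    simp only [hθ, id, Pi.sub_apply]
    ring
  · refine Eventually.of_forall fun t ht => ?_
    have htI := Set.Ioo_subset_Icc_self ht
    have hx := hwt t htI
    -- the only property of the tangent needed: it has the sign of its argument
    have htan : 0 ≤ t * Real.tan (w * t) := by
      rcases le_total 0 t with h | h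
      · exact mul_nonneg h (Real.tan_nonneg_of_nonneg_of_le_pi_div_two (by positivity) hx.2.le)
      · exact mul_nonneg_of_nonpos_of_nonpos h
          (Real.tan_nonpos_of_nonpos_of_neg_pi_div_two_le
            (mul_nonpos_of_nonneg_of_nonpos hw0.le h) hx.1.le)
    set T := Real.tan (w * t)
    set g := √(1 + t ^ 2 * κ ^ 2) with hg
    have hg0 : 0 < g := Real.sqrt_pos.2 (hpos t)
    have hgg : g ^ 2 = 1 + t ^ 2 * κ ^ 2 := Real.sq_sqrt (hpos t).le
    have htt : κ ^ 2 * t ^ 2 ≤ 2 := by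
      have : t ^ 2 ≤ a ^ 2 := by nlinarith [ht.1, ht.2]
      nlinarith [sq_nonneg κ]
    have hkey : g * (t * κ ^ 2 / g * θ t + g * (-w ^ 2 * (1 + T ^ 2) - κ ^ 2 / 6)
        + (g * θ t) ^ 2 / g) ≤ g * -((w ^ 2 + κ ^ 2 / 9) * g) := by
      have e1 : g * (t * κ ^ 2 / g * θ t + g * (-w ^ 2 * (1 + T ^ 2) - κ ^ 2 / 6)
        + (g * θ t) ^ 2 / g) = t * κ ^ 2 * θ t
          + g ^ 2 * (-w ^ 2 * (1 + T ^ 2) - κ ^ 2 / 6 + θ t ^ 2) := by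
        field_simp
        ring
      have e2 : g * -((w ^ 2 + κ ^ 2 / 9) * g) = -((w ^ 2 + κ ^ 2 / 9) * g ^ 2) := by ring
      rw [e1, e2, hgg]
      have hθt : θ t = -w * T - κ ^ 2 / 6 * t := rfl
      rw [hθt]
      have hz : 0 ≤ κ ^ 2 * (w * (t * T)) * (2 - κ ^ 2 * t ^ 2) :=
        mul_nonneg (by positivity) (by linarith)
      have hy : 0 ≤ κ ^ 2 * (κ ^ 2 * t ^ 2) := by positivity
      have hy2 : 0 ≤ κ ^ 2 * (2 - κ ^ 2 * t ^ 2) := mul_nonneg (sq_nonneg _) (by linarith)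
      have hy3 : 0 ≤ κ ^ 2 * (κ ^ 2 * t ^ 2) * (2 - κ ^ 2 * t ^ 2) :=
        mul_nonneg hy (by linarith)
      nlinarith [sq_nonneg κ]
    exact le_of_mul_le_mul_left hkey hg0
  · exact (hcont.mul ((hu.continuous_deriv le_rfl).norm.pow 2)).integrable_of_hasCompactSupport
      (hc.deriv.mono' (by
        intro x hx; apply subset_tsupport; intro h; apply hx; simp [h]))
  · exact ((continuous_const.mul hcont).mul
      (hu.continuous.norm.pow 2)).integrable_of_hasCompactSupport
      (hc.mono' (by
        intro x hx; apply subset_tsupport; intro h; apply hx; simp [h]))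

/-- The distribution function `I` of a mass `A` carried by `[-R, R]` and the distribution function
of the density `(A/π) / (1 + s²)` of the same mass differ by `O(1 / |s|)` at infinity. -/
theorem sub_arctan_sq_mul_le {A R I s : ℝ} (hR : 1 ≤ R) (hI0 : 0 ≤ I) (hIA : I ≤ A)
    (hl : s ≤ -R → I = 0) (hr : R ≤ s → I = A) :
    (I - A * (Real.arctan s / Real.pi + 1 / 2)) ^ 2 * (1 + s ^ 2) ≤ A ^ 2 * (1 + R ^ 2) := by
  have hπ := Real.pi_pos
  have hπ3 := Real.pi_gt_three
  have hA : 0 ≤ A := hI0.trans hIA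
  have harc : ∀ x : ℝ, 0 ≤ x → Real.arctan x ≤ x := fun x hx => by
    have := Real.le_tan (Real.arctan_nonneg.2 hx) (Real.arctan_lt_pi_div_two x)
    rwa [Real.tan_arctan] at this
  have hfar : ∀ x : ℝ, R ≤ x → (A * (Real.arctan x⁻¹ / Real.pi)) ^ 2 * (1 + x ^ 2)
      ≤ A ^ 2 * (1 + R ^ 2) := by
    intro x hx
    have hx0 : 0 < x := by linarith
    have h0 : 0 ≤ Real.arctan x⁻¹ := Real.arctan_nonneg.2 (by positivity)
    have h1 : Real.arctan x⁻¹ / Real.pi ≤ x⁻¹ := by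
      rw [div_le_iff₀ hπ]
      nlinarith [harc x⁻¹ (by positivity), inv_pos.2 hx0]
    have h2 : (Real.arctan x⁻¹ / Real.pi) ^ 2 ≤ x⁻¹ ^ 2 := by gcongr
    have h3 : x⁻¹ ^ 2 * (1 + x ^ 2) ≤ 1 + R ^ 2 := by
      have : x⁻¹ ^ 2 * (1 + x ^ 2) = x⁻¹ ^ 2 + 1 := by field_simp
      rw [this]
      have : x⁻¹ ≤ 1 := inv_le_one_of_one_le₀ (by linarith)
      nlinarith [inv_pos.2 hx0]
    calc _ = A ^ 2 * ((Real.arctan x⁻¹ / Real.pi) ^ 2 * (1 + x ^ 2)) := by ring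
      _ ≤ A ^ 2 * (x⁻¹ ^ 2 * (1 + x ^ 2)) := by gcongr
      _ ≤ _ := by gcongr
  rcases le_total R s with h | h
  · have := hfar s h
    rw [Real.arctan_inv_of_pos (by linarith)] at this
    rw [hr h]
    convert this using 2
    field_simp
    ring
  rcases le_total s (-R) with h' | h'
  · have := hfar (-s) (by linarith)
    rw [inv_neg, Real.arctan_neg, Real.arctan_inv_of_neg (by linarith)] at this
    rw [hl h']
    convert this using 2
    · field_simp
      ring
    · ring
  · have h1 : 0 ≤ Real.arctan s / Real.pi + 1 / 2 := by
      have := Real.neg_pi_div_two_lt_arctan s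
      have : -(1 / 2) ≤ Real.arctan s / Real.pi := by rw [le_div_iff₀ hπ]; linarith
      linarith
    have h2 : Real.arctan s / Real.pi + 1 / 2 ≤ 1 := by
      have := Real.arctan_lt_pi_div_two s
      have : Real.arctan s / Real.pi ≤ 1 / 2 := by rw [div_le_iff₀ hπ]; linarith
      linarith
    have h3 := mul_nonneg hA h1
    have h4 := mul_le_mul_of_nonneg_left h2 hA
    have h5 : (I - A * (Real.arctan s / Real.pi + 1 / 2)) ^ 2 ≤ A ^ 2 := by
      apply sq_le_sq'
      · linarith
      · linarith
    have h6 : s ^ 2 ≤ R ^ 2 := sq_le_sq' h' h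
    gcongr

/-- A nonnegative potential which does not vanish almost everywhere turns `-d²/ds²` on the line
into an operator bounded below by a Hardy weight. The Riccati solution is a small multiple of the
primitive of `V - (A/π) / (1 + s²)`, where `V` is the restriction of `W` to a bounded interval and
`A` its integral, so that it decays like `1 / s` and its square is bounded by the Hardy weight. -/
theorem exists_hardy_line {W : ℝ → ℝ} (hW : LocallyIntegrable W) (hW0 : ∀ s, 0 ≤ W s)
    (hne : ¬ W =ᵐ[volume] 0) :
    ∃ c : ℝ, 0 < c ∧ ∀ u : ℝ → E, ContDiff ℝ 1 u → HasCompactSupport u →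
      ∫ s, c / (1 + s ^ 2) * ‖u s‖ ^ 2 ≤ ∫ s, (‖deriv u s‖ ^ 2 + W s * ‖u s‖ ^ 2) := by
  obtain ⟨R, hR, hA⟩ : ∃ R : ℝ, 1 ≤ R ∧ 0 < ∫ s in (-R)..R, W s := by
    by_contra! hcon
    apply hne
    have hn : ∀ n : ℕ, ∀ᵐ s, s ∈ Set.Ioc (-(n + 1 : ℝ)) (n + 1) → W s = 0 := by
      intro n
      have h1 := hcon (n + 1) (by simp)
      rw [intervalIntegral.integral_of_le (by linarith [n.cast_nonneg (α := ℝ)])] at h1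
      have hint : IntegrableOn W (Set.Ioc (-(n + 1 : ℝ)) (n + 1)) :=
        (hW.integrableOn_isCompact isCompact_Icc).mono_set Set.Ioc_subset_Icc_self
      have h2 := (setIntegral_eq_zero_iff_of_nonneg_ae
        (Eventually.of_forall hW0) hint).1 (le_antisymm h1 (integral_nonneg hW0))
      exact (ae_restrict_iff' measurableSet_Ioc).1 h2
    filter_upwards [ae_all_iff.2 hn] with s hs
    obtain ⟨n, hn⟩ := exists_nat_gt |s|
    have := abs_lt.1 hn
    exact hs n ⟨by linarith, by linarith⟩
  set A := ∫ s in (-R)..R, W s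
  set V : ℝ → ℝ := (Set.Ioc (-R) R).indicator W with hV
  have hVi : Integrable V := by
    rw [hV, integrable_indicator_iff measurableSet_Ioc]
    exact (hW.integrableOn_isCompact isCompact_Icc).mono_set Set.Ioc_subset_Icc_self
  have hV0 : ∀ s, 0 ≤ V s := fun s => Set.indicator_nonneg (fun x _ => hW0 x) s
  have hVW : ∀ s, V s ≤ W s := fun s => Set.indicator_le_self' (fun x _ => hW0 x) s
  set J : ℝ → ℝ := fun s => ∫ x in (-R)..s, V x
  have hJR : J R = A := by
    refine intervalIntegral.integral_congr_ae (Eventually.of_forall fun x hx => ?_)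
    rw [Set.uIoc_of_le (by linarith)] at hx
    exact Set.indicator_of_mem hx _
  have hJmono : Monotone J := by
    intro x y hxy
    have : J y - J x = ∫ z in x..y, V z :=
      intervalIntegral.integral_interval_sub_left hVi.intervalIntegrable hVi.intervalIntegrable
    have := intervalIntegral.integral_nonneg hxy (μ := volume) fun z _ => hV0 z
    linarith
  have hJl : ∀ s ≤ -R, J s = 0 := by
    intro s hs
    refine intervalIntegral.integral_zero_ae (Eventually.of_forall fun x hx => ?_)
    rw [Set.uIoc_of_ge hs] at hx
    exact Set.indicator_of_notMem (fun h => absurd h.1 (not_lt.2 hx.2)) _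
  have hJr : ∀ s, R ≤ s → J s = A := by
    intro s hs
    have h1 : J s - J R = ∫ z in R..s, V z :=
      intervalIntegral.integral_interval_sub_left hVi.intervalIntegrable hVi.intervalIntegrable
    have h2 : ∫ z in R..s, V z = 0 := by
      refine intervalIntegral.integral_zero_ae (Eventually.of_forall fun x hx => ?_)
      rw [Set.uIoc_of_le hs] at hx
      exact Set.indicator_of_notMem (fun h => absurd h.2 (not_le.2 hx.1)) _
    linarith
  have hJ0 : ∀ s, 0 ≤ J s := fun s => by
    rcases le_total s (-R) with h | h
    · exact (hJl s h).ge
    · exact (hJl _ le_rfl).ge.trans (hJmono h)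
  have hJA : ∀ s, J s ≤ A := fun s => by
    rcases le_total s R with h | h
    · exact (hJmono h).trans hJR.le
    · exact (hJr s h).le
  have hπ := Real.pi_pos
  -- `ε ≤ 1` keeps `ε V ≤ W`; the other bound lets half of `ε (A/π) / (1 + s²)` absorb the square of
  -- the Riccati solution
  obtain ⟨ε, hε0, hε1, hε2⟩ : ∃ ε : ℝ, 0 < ε ∧ ε ≤ 1 ∧
      ε * (A ^ 2 * (1 + R ^ 2)) ≤ A / (2 * Real.pi) := by
    have hB : 0 < A ^ 2 * (1 + R ^ 2) := by positivity
    refine ⟨min 1 (A / (2 * Real.pi) / (A ^ 2 * (1 + R ^ 2))),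
      lt_min one_pos (by positivity), min_le_left _ _, ?_⟩
    rw [← le_div_iff₀ hB]
    exact min_le_right _ _
  set c := ε * A / (2 * Real.pi) with hc
  refine ⟨c, by positivity, fun u hu hcs => ?_⟩
  have hu2 : Continuous fun s => ‖u s‖ ^ 2 := hu.continuous.norm.pow 2
  have hu2c : HasCompactSupport fun s => ‖u s‖ ^ 2 := hcs.mono' (by
    intro x hx; apply subset_tsupport; intro h; apply hx; simp [h])
  have hd2i : Integrable fun s => 1 * ‖deriv u s‖ ^ 2 :=
    (continuous_const.mul ((hu.continuous_deriv le_rfl).norm.pow 2)).integrable_of_hasCompactSupport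
      (hcs.deriv.mono' (by
        intro x hx; apply subset_tsupport; intro h; apply hx; simp [h]))
  have hρ : Continuous fun s : ℝ => c / (1 + s ^ 2) :=
    continuous_const.div (by fun_prop) fun s => by positivity
  have hρi : Integrable fun s => c / (1 + s ^ 2) * ‖u s‖ ^ 2 :=
    (hρ.mul hu2).integrable_of_hasCompactSupport hu2c.mul_left
  have hWi : Integrable fun s => W s * ‖u s‖ ^ 2 :=
    hW.integrable_smul_right_of_hasCompactSupport hu2 hu2c
  obtain ⟨b, hb0, hsb⟩ : ∃ b, 0 < b ∧ tsupport u ⊆ Set.Ioo (-b) b := by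
    obtain ⟨b, hb⟩ := hcs.isCompact.isBounded.exists_norm_le
    refine ⟨|b| + 1, by positivity, fun x hx => abs_lt.1 ?_⟩
    have := hb x hx
    rw [Real.norm_eq_abs] at this
    linarith [le_abs_self b]
  have hmain := integral_mul_norm_sq_le_of_riccati hu (by linarith : -b < b) hsb
    (p := fun _ => 1) (q := fun s => c / (1 + s ^ 2) - W s)
    (F := fun s => ε * (J s - A * (Real.arctan s / Real.pi + 1 / 2)))
    (D := fun s => ε * (V s - A * (1 / (1 + s ^ 2) / Real.pi))) ?_ ?_ (fun _ => one_pos) ?_ hd2i ?_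
  · have e1 : ∫ s, (c / (1 + s ^ 2) - W s) * ‖u s‖ ^ 2
        = (∫ s, c / (1 + s ^ 2) * ‖u s‖ ^ 2) - ∫ s, W s * ‖u s‖ ^ 2 := by
      rw [← integral_sub hρi hWi]
      exact integral_congr_ae (Eventually.of_forall fun s => by ring)
    simp only [one_mul] at hmain hd2i
    rw [integral_add hd2i hWi]
    linarith
  · refine AbsolutelyContinuousOnInterval.const_mul ε (AbsolutelyContinuousOnInterval.sub ?_ ?_)
    · have h := (hVi.intervalIntegrable (a := -b) (b := b)
        ).absolutelyContinuousOnInterval_intervalIntegral (c := -b) (by simp)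
      have h2 : AbsolutelyContinuousOnInterval (fun _ : ℝ => ∫ x in (-R)..(-b), V x) (-b) b :=
        ContDiffOn.absolutelyContinuousOnInterval contDiffOn_const
      convert h2.add h using 1
      funext s
      exact (intervalIntegral.integral_add_adjacent_intervals hVi.intervalIntegrable
        hVi.intervalIntegrable).symm
    · refine ContDiffOn.absolutelyContinuousOnInterval (ContDiff.contDiffOn ?_)
      exact contDiff_const.mul ((Real.contDiff_arctan.div_const _).add contDiff_const)
  · filter_upwards [LocallyIntegrable.ae_hasDerivAt_integral hVi.locallyIntegrable] with s hs _
    exact ((hs (-R)).sub ((((Real.hasDerivAt_arctan s).div_const Real.pi).add_const _).const_mul A)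
      ).const_mul ε
  · refine Eventually.of_forall fun s _ => ?_
    have hs : 0 < 1 + s ^ 2 := by positivity
    have hsq := sub_arctan_sq_mul_le (s := s) hR (hJ0 s) (hJA s) (hJl s) (hJr s)
    set K := J s - A * (Real.arctan s / Real.pi + 1 / 2)
    have h1 : K ^ 2 ≤ A ^ 2 * (1 + R ^ 2) / (1 + s ^ 2) := (le_div_iff₀ hs).2 hsq
    have h2 : ε * V s ≤ W s := by nlinarith [hV0 s, hVW s]
    have h3 : ε * (ε * K ^ 2) ≤ ε * (A / (2 * Real.pi) / (1 + s ^ 2)) := by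
      refine mul_le_mul_of_nonneg_left ?_ hε0.le
      calc ε * K ^ 2 ≤ ε * (A ^ 2 * (1 + R ^ 2) / (1 + s ^ 2)) := by gcongr
        _ = ε * (A ^ 2 * (1 + R ^ 2)) / (1 + s ^ 2) := by ring
        _ ≤ _ := by gcongr
    have h4 : ε * (A * (1 / (1 + s ^ 2) / Real.pi)) = 2 * (c / (1 + s ^ 2)) := by
      rw [hc]; field_simp
    have h5 : ε * (A / (2 * Real.pi) / (1 + s ^ 2)) = c / (1 + s ^ 2) := by
      rw [hc]; ring
    simp only [div_one]
    nlinarith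
  · refine (hρi.sub hWi).congr (Eventually.of_forall fun s => ?_)
    simp only [Pi.sub_apply]
    ring

end Line

/-! ### The inequality for test functions on the straight strip -/

section Test

variable {E : Type*} [NormedAddCommGroup E] [InnerProductSpace ℝ E]

theorem hasCompactSupport_comp_of_isClosedEmbedding {F : Type*} [NormedAddCommGroup F]
    {φ : ℝ × ℝ → F} (hc : HasCompactSupport φ)
    {i : ℝ → ℝ × ℝ} (hi : IsClosedEmbedding i) :
    HasCompactSupport (fun x => φ (i x)) ∧ tsupport (fun x => φ (i x)) ⊆ i ⁻¹' tsupport φ :=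
  ⟨hc.comp_isClosedEmbedding hi, closure_minimal
    (fun _ hx => subset_tsupport φ hx) ((isClosed_tsupport φ).preimage hi.continuous)⟩

theorem isClosedEmbedding_prodMk_left (s : ℝ) : IsClosedEmbedding fun t : ℝ => (s, t) :=
  (Isometry.of_dist_eq fun t t' => by simp [Prod.dist_eq]).isClosedEmbedding

theorem isClosedEmbedding_prodMk_right (t : ℝ) : IsClosedEmbedding fun s : ℝ => (s, t) :=
  (Isometry.of_dist_eq fun s s' => by simp [Prod.dist_eq]).isClosedEmbedding

theorem deriv_slice_snd {φ : ℝ × ℝ → E} (hφ : Differentiable ℝ φ) (s t : ℝ) :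
    deriv (fun t => φ (s, t)) t = fderiv ℝ φ (s, t) (0, 1) :=
  ((hφ (s, t)).hasFDerivAt.comp_hasDerivAt t
    ((hasDerivAt_const t s).prodMk (hasDerivAt_id t))).deriv

theorem deriv_slice_fst {φ : ℝ × ℝ → E} (hφ : Differentiable ℝ φ) (s t : ℝ) :
    deriv (fun s => φ (s, t)) s = fderiv ℝ φ (s, t) (1, 0) :=
  ((hφ (s, t)).hasFDerivAt.comp_hasDerivAt s
    ((hasDerivAt_id s).prodMk (hasDerivAt_const s t))).deriv

theorem integrable_mul_norm_sq_of_bounded {F : Type*} [NormedAddCommGroup F]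
    {v : ℝ × ℝ → F} (hv : Continuous v) (hc : HasCompactSupport v) {m : ℝ × ℝ → ℝ} (hm : Measurable m) {C : ℝ}
    (hC : ∀ x ∈ tsupport v, |m x| ≤ C) : Integrable fun x => m x * ‖v x‖ ^ 2 := by
  have hi : Integrable fun x => C * ‖v x‖ ^ 2 :=
    (continuous_const.mul (hv.norm.pow 2)).integrable_of_hasCompactSupport (hc.mono' (by
      intro x hx; apply subset_tsupport; intro h; apply hx; simp [h]))
  refine hi.mono' (hm.aestronglyMeasurable.mul (hv.norm.pow 2).aestronglyMeasurable)
    (Eventually.of_forall fun x => ?_)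
  rw [norm_mul, Real.norm_eq_abs, norm_pow, norm_norm]
  by_cases hx : x ∈ tsupport v
  · gcongr
    exact hC x hx
  · simp [image_eq_zero_of_notMem_tsupport hx]

/-- The Jacobian `√(1 + t² κ(s)²)` of a strip whose geodesic curvature vanishes and whose twisting
speed is `κ`. -/
noncomputable def twistJacobian (κ : ℝ → ℝ) (x : ℝ × ℝ) : ℝ := √(1 + x.2 ^ 2 * κ x.1 ^ 2)

theorem measurable_twistJacobian {κ : ℝ → ℝ} (hκ : Measurable κ) :
    Measurable (twistJacobian κ) := by
  unfold twistJacobian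
  fun_prop

theorem one_le_twistJacobian (κ : ℝ → ℝ) (x : ℝ × ℝ) : 1 ≤ twistJacobian κ x :=
  Real.one_le_sqrt.2 (le_add_of_nonneg_right (by positivity))

theorem twistJacobian_le_two {κ : ℝ → ℝ} {a : ℝ} (hκ : ∀ s, κ s ^ 2 * a ^ 2 ≤ 2) {x : ℝ × ℝ}
    (hx : x.2 ∈ Set.Ioo (-a) a) : twistJacobian κ x ≤ 2 := by
  have h1 : x.2 ^ 2 ≤ a ^ 2 := by nlinarith [hx.1, hx.2]
  have h2 := hκ x.1
  refine Real.sqrt_le_iff.2 ⟨by norm_num, ?_⟩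
  nlinarith [sq_nonneg (κ x.1)]

theorem integrable_mul_norm_sq_of_le_twistJacobian {F : Type*} [NormedAddCommGroup F]
    {κ : ℝ → ℝ} {a : ℝ} (hκ : ∀ s, κ s ^ 2 * a ^ 2 ≤ 2) {v : ℝ × ℝ → F} (hv : Continuous v)
    (hc : HasCompactSupport v) (hs : tsupport v ⊆ Set.univ ×ˢ Set.Ioo (-a) a)
    {m : ℝ × ℝ → ℝ} (hm : Measurable m) (hm0 : ∀ x, 0 ≤ m x)
    (hmg : ∀ x, m x ≤ twistJacobian κ x) : Integrable fun x => m x * ‖v x‖ ^ 2 :=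
  integrable_mul_norm_sq_of_bounded hv hc hm fun x hx => by
    rw [abs_of_nonneg (hm0 x)]
    exact (hmg x).trans (twistJacobian_le_two hκ (hs hx).2)

theorem inv_twistJacobian_le (κ : ℝ → ℝ) (x : ℝ × ℝ) :
    (twistJacobian κ x)⁻¹ ≤ twistJacobian κ x :=
  (inv_le_one_of_one_le₀ (one_le_twistJacobian κ x)).trans (one_le_twistJacobian κ x)

theorem hardyWeight_mul_twistJacobian_le (κ : ℝ → ℝ) (x : ℝ × ℝ) :
    hardyWeight x * twistJacobian κ x ≤ twistJacobian κ x := by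
  refine mul_le_of_le_one_left (zero_le_one.trans (one_le_twistJacobian κ x)) ?_
  rw [hardyWeight, div_le_one (by positivity)]
  nlinarith [sq_nonneg x.1]

theorem measurable_hardyWeight : Measurable hardyWeight := by
  unfold hardyWeight
  fun_prop

theorem hardyWeight_nonneg (x : ℝ × ℝ) : 0 ≤ hardyWeight x := by
  unfold hardyWeight
  positivity

/-- Hardy inequality for compactly supported functions on a purely twisted strip. On every
cross-section the transverse energy exceeds the threshold by `κ² / 9`, and this surplus, together
with the longitudinal energy, feeds the Hardy inequality on every longitudinal line. -/
theorem exists_hardy_test {a : ℝ} (ha : 0 < a) {κ : ℝ → ℝ} (hκm : Measurable κ)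
    (hκ : ∀ s, κ s ^ 2 * a ^ 2 ≤ 2) (hne : ¬ κ =ᵐ[volume] 0) :
    ∃ c : ℝ, 0 < c ∧ ∀ φ : ℝ × ℝ → E, ContDiff ℝ 1 φ → HasCompactSupport φ →
      tsupport φ ⊆ Set.univ ×ˢ Set.Ioo (-a) a →
      c * (∫ x, hardyWeight x * twistJacobian κ x * ‖φ x‖ ^ 2)
        + (Real.pi / (2 * a)) ^ 2 * ∫ x, twistJacobian κ x * ‖φ x‖ ^ 2
      ≤ (∫ x, (twistJacobian κ x)⁻¹ * ‖fderiv ℝ φ x (1, 0)‖ ^ 2)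
        + ∫ x, twistJacobian κ x * ‖fderiv ℝ φ x (0, 1)‖ ^ 2 := by
  have hκb : ∀ s, κ s ^ 2 ≤ 2 / a ^ 2 := fun s => (le_div_iff₀ (by positivity)).2 (hκ s)
  obtain ⟨c, hc, hH⟩ := exists_hardy_line (E := E) (W := fun s => 2 * (κ s ^ 2 / 9))
    (by
      refine (locallyIntegrable_const (2 / a ^ 2)).mono (by fun_prop)
        (Eventually.of_forall fun s => ?_)
      have h1 := hκb s
      have h2 := sq_nonneg (κ s)
      rw [Real.norm_of_nonneg (by positivity), Real.norm_of_nonneg (by positivity)]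
      linarith)
    (fun s => by positivity)
    (fun h => hne (by
      filter_upwards [h] with s hs
      simpa using hs))
  refine ⟨c / 4, by positivity, fun φ hφ hφc hφs => ?_⟩
  set g := twistJacobian κ with hg
  have hgm : Measurable g := measurable_twistJacobian hκm
  have hg1 : ∀ x, 1 ≤ g x := one_le_twistJacobian κ
  have hg0 : ∀ x, 0 < g x := fun x => one_pos.trans_le (hg1 x)
  have hφ1 : Continuous fun x => fderiv ℝ φ x (1, 0) :=
    (hφ.continuous_fderiv one_ne_zero).clm_apply continuous_const
  have hφ2 : Continuous fun x => fderiv ℝ φ x (0, 1) :=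
    (hφ.continuous_fderiv one_ne_zero).clm_apply continuous_const
  have hts : ∀ e, tsupport (fun x => fderiv ℝ φ x e) ⊆ tsupport φ := fun e =>
    tsupport_fderiv_apply_subset ℝ e
  have hφ1c : HasCompactSupport fun x => fderiv ℝ φ x (1, 0) := hφc.fderiv_apply ℝ _
  have hφ2c : HasCompactSupport fun x => fderiv ℝ φ x (0, 1) := hφc.fderiv_apply ℝ _
  have hg2 : ∀ x ∈ tsupport φ, g x ≤ 2 := fun x hx =>
    twistJacobian_le_two hκ (hφs hx).2
  have hρ : ∀ s : ℝ, 1 / (1 + s ^ 2) ≤ 1 := fun s => by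
    rw [div_le_one (by positivity)]; nlinarith [sq_nonneg s]
  have hdiff := hφ.differentiable one_ne_zero
  have i1 : Integrable fun x => hardyWeight x * g x * ‖φ x‖ ^ 2 :=
    integrable_mul_norm_sq_of_le_twistJacobian hκ hφ.continuous hφc hφs
      (measurable_hardyWeight.mul hgm) (fun x => mul_nonneg (hardyWeight_nonneg x) (hg0 x).le)
      (hardyWeight_mul_twistJacobian_le κ)
  have i2 : Integrable fun x => g x * ‖φ x‖ ^ 2 :=
    integrable_mul_norm_sq_of_le_twistJacobian hκ hφ.continuous hφc hφs hgm
      (fun x => (hg0 x).le) fun _ => le_rfl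
  have i3 : Integrable fun x => (g x)⁻¹ * ‖fderiv ℝ φ x (1, 0)‖ ^ 2 :=
    integrable_mul_norm_sq_of_le_twistJacobian hκ hφ1 hφ1c ((hts _).trans hφs) hgm.inv
      (fun x => (inv_pos.2 (hg0 x)).le) (inv_twistJacobian_le κ)
  have i4 : Integrable fun x => g x * ‖fderiv ℝ φ x (0, 1)‖ ^ 2 :=
    integrable_mul_norm_sq_of_le_twistJacobian hκ hφ2 hφ2c ((hts _).trans hφs) hgm
      (fun x => (hg0 x).le) fun _ => le_rfl
  have i5 : Integrable fun x : ℝ × ℝ => ((Real.pi / (2 * a)) ^ 2 + κ x.1 ^ 2 / 9) * g x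
      * ‖φ x‖ ^ 2 :=
    integrable_mul_norm_sq_of_bounded hφ.continuous hφc (by fun_prop)
      (C := ((Real.pi / (2 * a)) ^ 2 + 2 / a ^ 2 / 9) * 2) fun x hx => by
      rw [abs_of_nonneg (mul_nonneg (by positivity) (hg0 x).le)]
      have := hκb x.1
      have := hg2 x hx
      have := (hg0 x).le
      gcongr
  have i6 : Integrable fun x : ℝ × ℝ => κ x.1 ^ 2 / 9 * g x * ‖φ x‖ ^ 2 :=
    (i5.sub (i2.const_mul ((Real.pi / (2 * a)) ^ 2))).congr
      (Eventually.of_forall fun x => by simp only [Pi.sub_apply]; ring)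
  have i7 : Integrable fun x : ℝ × ℝ => c / (1 + x.1 ^ 2) * ‖φ x‖ ^ 2 :=
    integrable_mul_norm_sq_of_bounded hφ.continuous hφc (by fun_prop) (C := c) fun x _ => by
      rw [abs_of_pos (by positivity : 0 < c / (1 + x.1 ^ 2))]
      have := hρ x.1
      have e : c / (1 + x.1 ^ 2) = c * (1 / (1 + x.1 ^ 2)) := by ring
      rw [e]; nlinarith
  have i8 : Integrable fun x : ℝ × ℝ => ‖fderiv ℝ φ x (1, 0)‖ ^ 2
      + 2 * (κ x.1 ^ 2 / 9) * ‖φ x‖ ^ 2 := by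
    refine Integrable.add ?_ ?_
    · simpa using integrable_mul_norm_sq_of_bounded hφ1 hφ1c (m := fun _ => 1)
        measurable_const (C := 1) (by simp)
    · refine integrable_mul_norm_sq_of_bounded hφ.continuous hφc (by fun_prop)
        (C := 2 * (2 / a ^ 2 / 9)) fun x _ => ?_
      rw [abs_of_nonneg (by positivity)]
      have := hκb x.1
      gcongr
  have hT : ∫ x : ℝ × ℝ, ((Real.pi / (2 * a)) ^ 2 + κ x.1 ^ 2 / 9) * g x * ‖φ x‖ ^ 2
      ≤ ∫ x, g x * ‖fderiv ℝ φ x (0, 1)‖ ^ 2 := by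
    rw [Measure.volume_eq_prod, integral_prod _ i5, integral_prod _ i4]
    refine integral_mono i5.integral_prod_left i4.integral_prod_left fun s => ?_
    have hsl := hasCompactSupport_comp_of_isClosedEmbedding hφc (isClosedEmbedding_prodMk_left s)
    have := integral_transverse_le ha (hκ s) (u := fun t => φ (s, t))
      (hφ.comp (contDiff_const.prodMk contDiff_id)) hsl.1
      (fun t ht => (hφs (hsl.2 ht)).2)
    simp only [deriv_slice_snd hdiff] at this
    exact this
  have hL : ∫ x : ℝ × ℝ, c / (1 + x.1 ^ 2) * ‖φ x‖ ^ 2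
      ≤ ∫ x : ℝ × ℝ, (‖fderiv ℝ φ x (1, 0)‖ ^ 2 + 2 * (κ x.1 ^ 2 / 9) * ‖φ x‖ ^ 2) := by
    rw [Measure.volume_eq_prod, integral_prod_symm _ i7, integral_prod_symm _ i8]
    refine integral_mono i7.integral_prod_right i8.integral_prod_right fun t => ?_
    have hsl := hasCompactSupport_comp_of_isClosedEmbedding hφc (isClosedEmbedding_prodMk_right t)
    have := hH (fun s => φ (s, t)) (hφ.comp (contDiff_id.prodMk contDiff_const)) hsl.1
    simp only [deriv_slice_fst hdiff] at this
    exact this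
  -- half of the longitudinal energy suffices since `1 / 2 ≤ 1 / g`, and `g ≤ 2` costs a factor `2`
  -- in the Hardy term; hence the constant `c / 4`
  have hM1 : c / 4 * (∫ x, hardyWeight x * g x * ‖φ x‖ ^ 2)
      ≤ 1 / 2 * ∫ x : ℝ × ℝ, c / (1 + x.1 ^ 2) * ‖φ x‖ ^ 2 := by
    rw [← integral_const_mul, ← integral_const_mul]
    refine integral_mono (i1.const_mul _) (i7.const_mul _) fun x => ?_
    by_cases hx : x ∈ tsupport φ
    · have h := mul_le_mul_of_nonneg_left (hg2 x hx)
        (by positivity : 0 ≤ c / (1 + x.1 ^ 2) / 4 * ‖φ x‖ ^ 2)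
      calc c / 4 * (hardyWeight x * g x * ‖φ x‖ ^ 2)
          = c / (1 + x.1 ^ 2) / 4 * ‖φ x‖ ^ 2 * g x := by rw [hardyWeight]; ring
        _ ≤ _ := h
        _ = _ := by ring
    · simp [image_eq_zero_of_notMem_tsupport hx]
  have hM2 : 1 / 2 * ∫ x : ℝ × ℝ, (‖fderiv ℝ φ x (1, 0)‖ ^ 2 + 2 * (κ x.1 ^ 2 / 9) * ‖φ x‖ ^ 2)
      ≤ (∫ x, (g x)⁻¹ * ‖fderiv ℝ φ x (1, 0)‖ ^ 2)
        + ∫ x : ℝ × ℝ, κ x.1 ^ 2 / 9 * g x * ‖φ x‖ ^ 2 := by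
    rw [← integral_const_mul, ← integral_add i3 i6]
    refine integral_mono (i8.const_mul _) (i3.add i6) fun x => ?_
    by_cases hx : x ∈ tsupport φ
    · have h1 : 1 / 2 ≤ (g x)⁻¹ := by
        rw [one_div]; exact inv_anti₀ (hg0 x) (hg2 x hx)
      have h2 := mul_le_mul_of_nonneg_right h1 (sq_nonneg ‖fderiv ℝ φ x (1, 0)‖)
      have h3 := mul_le_mul_of_nonneg_left (hg1 x)
        (by positivity : 0 ≤ κ x.1 ^ 2 / 9 * ‖φ x‖ ^ 2)
      simp only
      nlinarith
    · have h1 : fderiv ℝ φ x (1, 0) = 0 :=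
        image_eq_zero_of_notMem_tsupport (f := fun x => fderiv ℝ φ x (1, 0))
          fun h => hx (hts _ h)
      simp [image_eq_zero_of_notMem_tsupport hx, h1]
  have hS : ∫ x : ℝ × ℝ, ((Real.pi / (2 * a)) ^ 2 + κ x.1 ^ 2 / 9) * g x * ‖φ x‖ ^ 2
      = (Real.pi / (2 * a)) ^ 2 * (∫ x, g x * ‖φ x‖ ^ 2)
        + ∫ x : ℝ × ℝ, κ x.1 ^ 2 / 9 * g x * ‖φ x‖ ^ 2 := by
    rw [← integral_const_mul, ← integral_add (i2.const_mul _) i6]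
    exact integral_congr_ae (Eventually.of_forall fun x => by simp only; ring)
  linarith

end Test

/-! ### Passage to the form domain -/

section L2

variable {α E : Type*} {mα : MeasurableSpace α} {ν : Measure α} [NormedAddCommGroup E]

theorem norm_toLp_sq {F : α → E} (hF : MemLp F 2 ν) :
    ‖hF.toLp F‖ ^ 2 = ∫ x, ‖F x‖ ^ 2 ∂ν := by
  rw [Lp.norm_toLp, hF.eLpNorm_eq_integral_rpow_norm two_ne_zero ENNReal.ofNat_ne_top,
    ENNReal.toReal_ofReal (by positivity)]
  simp only [ENNReal.toReal_ofNat, Real.rpow_two]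
  rw [← Real.rpow_natCast, ← Real.rpow_mul (by positivity)]
  norm_num

theorem tendsto_integral_norm_sq {F : ℕ → α → E} {G : α → E} (hF : ∀ m, MemLp (F m) 2 ν)
    (hG : AEStronglyMeasurable G ν)
    (h : Tendsto (fun m => ∫⁻ x, ‖F m x - G x‖ₑ ^ 2 ∂ν) atTop (𝓝 0)) :
    Tendsto (fun m => ∫ x, ‖F m x‖ ^ 2 ∂ν) atTop (𝓝 (∫ x, ‖G x‖ ^ 2 ∂ν)) := by
  have hlim : Tendsto (fun m => eLpNorm (F m - G) 2 ν) atTop (𝓝 0) := by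
    have h3 := (ENNReal.continuous_rpow_const (y := (1 / 2 : ℝ))).tendsto 0 |>.comp h
    rw [ENNReal.zero_rpow_of_pos (by norm_num)] at h3
    refine h3.congr fun m => ?_
    rw [eLpNorm_eq_lintegral_rpow_enorm_toReal two_ne_zero ENNReal.ofNat_ne_top]
    simp
  obtain ⟨m, hm⟩ := (hlim.eventually_lt_const ENNReal.zero_lt_top).exists
  have hGL : MemLp G 2 ν := by
    have := (hF m).sub (⟨(hF m).1.sub hG, hm⟩ : MemLp (F m - G) 2 ν)
    simpa using this
  have ht := ((Lp.tendsto_Lp_iff_tendsto_eLpNorm'' F hF G hGL).2 hlim).norm.pow 2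
  simpa only [norm_toLp_sq] using ht

theorem tendsto_integral_mul_norm_sq [NormedSpace ℝ E] {w : α → ℝ} (hw : Measurable w)
    (hw0 : ∀ x, 0 ≤ w x) {F : ℕ → α → E} {G : α → E} (hF : ∀ m, AEStronglyMeasurable (F m) ν)
    (hFi : ∀ m, Integrable (fun x => w x * ‖F m x‖ ^ 2) ν) (hG : AEStronglyMeasurable G ν)
    (h : Tendsto (fun m => ∫⁻ x, ‖F m x - G x‖ₑ ^ 2 * ENNReal.ofReal (w x) ∂ν) atTop (𝓝 0)) :
    Tendsto (fun m => ∫ x, w x * ‖F m x‖ ^ 2 ∂ν) atTop (𝓝 (∫ x, w x * ‖G x‖ ^ 2 ∂ν)) := by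
  have hsm : AEStronglyMeasurable (fun x => √(w x)) ν := hw.sqrt.aestronglyMeasurable
  have hn : ∀ (x : α) (y : E), ‖√(w x) • y‖ ^ 2 = w x * ‖y‖ ^ 2 := fun x y => by
    rw [norm_smul, mul_pow, Real.norm_of_nonneg (Real.sqrt_nonneg _), Real.sq_sqrt (hw0 x)]
  have key := tendsto_integral_norm_sq (ν := ν) (F := fun m x => √(w x) • F m x)
    (G := fun x => √(w x) • G x) (fun m => ?_) (hsm.smul hG) ?_
  · simpa only [hn] using key
  · refine (memLp_two_iff_integrable_sq_norm (hsm.smul (hF m))).2 ?_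
    simpa only [Pi.smul_apply', hn] using hFi m
  · refine h.congr fun m => lintegral_congr fun x => ?_
    rw [← smul_sub, ← ofReal_norm, ← ofReal_norm, ← ENNReal.ofReal_pow (norm_nonneg _),
      ← ENNReal.ofReal_pow (norm_nonneg _), hn, ← ENNReal.ofReal_mul (by positivity), mul_comm]

end L2

section Domain

variable {n : ℕ} (S : Strip n)

theorem isWeakDeriv_weakDeriv {e : ℝ × ℝ} {ψ : ℝ × ℝ → ℂ} (h : ∃ u, S.IsWeakDeriv e ψ u) :
    S.IsWeakDeriv e ψ (S.weakDeriv e ψ) := by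
  rw [weakDeriv, dif_pos h]
  exact h.choose_spec

/-- On a purely twisted strip the Jacobian is `√(1 + t² κ(s)²)` with a twisting speed `κ` which is
bounded everywhere, not only almost everywhere. -/
theorem exists_f_ae_eq_twistJacobian (ha : 0 < S.a) (hunbent : S.kΘ =ᵐ[volume] 0)
    (htwisted : ¬ deriv S.Θ =ᵐ[volume] 0)
    (hsmall : ENNReal.ofReal S.a * eLpNorm (deriv S.Θ) ∞ volume ≤ ENNReal.ofReal (√2)) :
    ∃ κ : ℝ → ℝ, Measurable κ ∧ (∀ s, κ s ^ 2 * S.a ^ 2 ≤ 2) ∧ (¬ κ =ᵐ[volume] 0) ∧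
      S.f =ᵐ[volume] twistJacobian κ := by
  have hb : ∀ᵐ s, ‖deriv S.Θ s‖ ≤ √2 / S.a := by
    filter_upwards [ae_le_eLpNormEssSup (f := deriv S.Θ) (μ := volume)] with s hs
    rw [← eLpNorm_exponent_top] at hs
    have h1 := (mul_le_mul_right hs (ENNReal.ofReal S.a)).trans hsmall
    rw [← ofReal_norm, ← ENNReal.ofReal_mul ha.le,
      ENNReal.ofReal_le_ofReal_iff (Real.sqrt_nonneg _)] at h1
    rw [le_div_iff₀ ha]
    linarith
  have hae : ∀ᵐ s, min ‖deriv S.Θ s‖ (√2 / S.a) = ‖deriv S.Θ s‖ := by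
    filter_upwards [hb] with s hs using min_eq_left hs
  refine ⟨fun s => min ‖deriv S.Θ s‖ (√2 / S.a),
    (measurable_deriv S.Θ).norm.min measurable_const, fun s => ?_, fun h => htwisted ?_, ?_⟩
  · have h0 : 0 ≤ min ‖deriv S.Θ s‖ (√2 / S.a) := le_min (norm_nonneg _) (by positivity)
    rw [← mul_pow]
    calc (min ‖deriv S.Θ s‖ (√2 / S.a) * S.a) ^ 2 ≤ (√2 / S.a * S.a) ^ 2 := by
          gcongr
          exact min_le_right _ _
      _ = 2 := by rw [div_mul_cancel₀ _ ha.ne', Real.sq_sqrt (by norm_num)]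
  · filter_upwards [h, hae] with s h1 h2
    rw [h2] at h1
    simpa using h1
  · have h := hunbent.and hae
    filter_upwards [Measure.quasiMeasurePreserving_fst (μ := (volume : Measure ℝ))
      (ν := (volume : Measure ℝ)) |>.ae h] with x hx
    rw [f, twistJacobian, hx.1, hx.2]
    simp

variable {S} in
/-- The form inequality extends from test functions to the form domain because each of its four
terms is the square of a weighted `L²` norm which is continuous for the form norm. -/
theorem hardy_formDomain {κ : ℝ → ℝ} (hκm : Measurable κ) (hκ : ∀ s, κ s ^ 2 * S.a ^ 2 ≤ 2)
    (hf : S.f =ᵐ[volume] twistJacobian κ) {c : ℝ}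
    (hc : ∀ φ : ℝ × ℝ → ℂ, ContDiff ℝ 1 φ → HasCompactSupport φ →
      tsupport φ ⊆ Set.univ ×ˢ Set.Ioo (-S.a) S.a →
      c * (∫ x, hardyWeight x * twistJacobian κ x * ‖φ x‖ ^ 2)
        + S.E₁ * ∫ x, twistJacobian κ x * ‖φ x‖ ^ 2
      ≤ (∫ x, (twistJacobian κ x)⁻¹ * ‖fderiv ℝ φ x (1, 0)‖ ^ 2)
        + ∫ x, twistJacobian κ x * ‖fderiv ℝ φ x (0, 1)‖ ^ 2)
    {ψ : S.HilbertSpace} (hψ : ψ ∈ S.formDomain) :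
    c * S.hardyTerm ψ ≤ S.form ψ - S.E₁ * ‖ψ‖ ^ 2 := by
  obtain ⟨h1, h2, φ, hφ, hlim⟩ := hψ
  set g := twistJacobian κ with hg
  have hgm : Measurable g := measurable_twistJacobian hκm
  have hg0 : ∀ x, 0 < g x := fun x => one_pos.trans_le (one_le_twistJacobian κ x)
  have hfΩ : ∀ᵐ x ∂(volume.restrict S.Ω₀), S.f x = g x := ae_restrict_of_ae hf
  have hμ : S.stripMeasure
      = (volume.restrict S.Ω₀).withDensity fun x => ENNReal.ofReal (g x) := by
    refine withDensity_congr_ae ?_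
    filter_upwards [hfΩ] with x hx
    rw [hx]
  have hμint : ∀ F : ℝ × ℝ → ℝ, ∫ x, F x ∂S.stripMeasure = ∫ x in S.Ω₀, g x * F x := by
    intro F
    rw [hμ, integral_withDensity_eq_integral_toReal_smul hgm.ennreal_ofReal
      (Eventually.of_forall fun x => ENNReal.ofReal_lt_top)]
    refine integral_congr_ae (Eventually.of_forall fun x => ?_)
    simp only [ENNReal.toReal_ofReal (hg0 x).le, smul_eq_mul]
  have w1 := S.isWeakDeriv_weakDeriv h1
  have w2 := S.isWeakDeriv_weakDeriv h2
  have m0 := w1.locallyIntegrableOn.aestronglyMeasurable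
  have m1 := w1.locallyIntegrableOn_deriv.aestronglyMeasurable
  have m2 := w2.locallyIntegrableOn_deriv.aestronglyMeasurable
  have eH : S.hardyTerm ψ = ∫ x in S.Ω₀, hardyWeight x * g x * ‖ψ x‖ ^ 2 := by
    rw [hardyTerm, hμint]
    exact integral_congr_ae (Eventually.of_forall fun x => by simp only; ring)
  have eN : ‖ψ‖ ^ 2 = ∫ x in S.Ω₀, g x * ‖ψ x‖ ^ 2 := by
    rw [← hμint, ← norm_toLp_sq (Lp.memLp ψ), Lp.toLp_coeFn]
  have eF : S.form ψ = (∫ x in S.Ω₀, (g x)⁻¹ * ‖S.partial₁ ψ x‖ ^ 2)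
      + ∫ x in S.Ω₀, g x * ‖S.partial₂ ψ x‖ ^ 2 := by
    rw [form]
    congr 1
    · refine integral_congr_ae ?_
      filter_upwards [hfΩ] with x hx
      rw [hx]; ring
    · refine integral_congr_ae ?_
      filter_upwards [hfΩ] with x hx
      rw [hx]; ring
  have l1 : Tendsto (fun m => ∫⁻ x in S.Ω₀, ‖fderiv ℝ (φ m) x (1, 0) - S.partial₁ ψ x‖ₑ ^ 2
      * ENNReal.ofReal (g x)⁻¹) atTop (𝓝 0) := by
    refine tendsto_of_tendsto_of_tendsto_of_le_of_le tendsto_const_nhds hlim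
      (fun _ => zero_le) fun m => ?_
    refine le_trans (le_of_eq (lintegral_congr_ae ?_)) (le_self_add.trans le_self_add)
    filter_upwards [hfΩ] with x hx
    rw [hx, div_eq_mul_inv, ENNReal.ofReal_inv_of_pos (hg0 x)]
  have l2 : Tendsto (fun m => ∫⁻ x in S.Ω₀, ‖fderiv ℝ (φ m) x (0, 1) - S.partial₂ ψ x‖ₑ ^ 2
      * ENNReal.ofReal (g x)) atTop (𝓝 0) := by
    refine tendsto_of_tendsto_of_tendsto_of_le_of_le tendsto_const_nhds hlim
      (fun _ => zero_le) fun m => ?_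
    refine le_trans (le_of_eq (lintegral_congr_ae ?_)) (le_add_self.trans le_self_add)
    filter_upwards [hfΩ] with x hx
    rw [hx]
  have l3 : Tendsto (fun m => ∫⁻ x in S.Ω₀, ‖φ m x - ψ x‖ₑ ^ 2 * ENNReal.ofReal (g x))
      atTop (𝓝 0) := by
    refine tendsto_of_tendsto_of_tendsto_of_le_of_le tendsto_const_nhds hlim
      (fun _ => zero_le) fun m => ?_
    refine le_trans (le_of_eq (lintegral_congr_ae ?_)) le_add_self
    filter_upwards [hfΩ] with x hx
    rw [hx]
  have l4 : Tendsto (fun m => ∫⁻ x in S.Ω₀, ‖φ m x - ψ x‖ₑ ^ 2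
      * ENNReal.ofReal (hardyWeight x * g x)) atTop (𝓝 0) := by
    refine tendsto_of_tendsto_of_tendsto_of_le_of_le tendsto_const_nhds l3
      (fun _ => zero_le) fun m => lintegral_mono fun x => ?_
    simp only
    gcongr
    exact hardyWeight_mul_twistJacobian_le κ x
  have cφ : ∀ m, ContDiff ℝ 1 (φ m) := fun m =>
    (hφ m).contDiff.of_le (by exact_mod_cast le_top)
  have c0 : ∀ m, Continuous (φ m) := fun m => (cφ m).continuous
  have cd : ∀ e m, Continuous fun x => fderiv ℝ (φ m) x e := fun e m =>
    ((cφ m).continuous_fderiv one_ne_zero).clm_apply continuous_const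
  have sd : ∀ e m, tsupport (fun x => fderiv ℝ (φ m) x e) ⊆ S.Ω₀ := fun e m =>
    (tsupport_fderiv_apply_subset ℝ e).trans (hφ m).tsupport_subset
  have kd : ∀ e m, HasCompactSupport fun x => fderiv ℝ (φ m) x e := fun e m =>
    (hφ m).hasCompactSupport.fderiv_apply ℝ e
  have hwm : Measurable fun x => hardyWeight x * g x := measurable_hardyWeight.mul hgm
  have hw0 : ∀ x, 0 ≤ hardyWeight x * g x := fun x =>
    mul_nonneg (hardyWeight_nonneg x) (hg0 x).le
  have hfull : ∀ (w : ℝ × ℝ → ℝ) (v : ℝ × ℝ → ℂ), tsupport v ⊆ S.Ω₀ →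
      ∫ x in S.Ω₀, w x * ‖v x‖ ^ 2 = ∫ x, w x * ‖v x‖ ^ 2 := fun w v hv =>
    setIntegral_eq_integral_of_forall_compl_eq_zero fun x hx => by
      simp [image_eq_zero_of_notMem_tsupport fun h => hx (hv h)]
  have t1 := tendsto_integral_mul_norm_sq hgm.inv (fun x => (inv_pos.2 (hg0 x)).le)
    (fun m => (cd (1, 0) m).aestronglyMeasurable)
    (fun m => (integrable_mul_norm_sq_of_le_twistJacobian hκ (cd (1, 0) m) (kd _ m) (sd _ m)
      hgm.inv (fun x => (inv_pos.2 (hg0 x)).le) (inv_twistJacobian_le κ)).restrict) m1 l1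
  have t2 := tendsto_integral_mul_norm_sq hgm (fun x => (hg0 x).le)
    (fun m => (cd (0, 1) m).aestronglyMeasurable)
    (fun m => (integrable_mul_norm_sq_of_le_twistJacobian hκ (cd (0, 1) m) (kd _ m) (sd _ m)
      hgm (fun x => (hg0 x).le) fun _ => le_rfl).restrict) m2 l2
  have t3 := tendsto_integral_mul_norm_sq hgm (fun x => (hg0 x).le)
    (fun m => (c0 m).aestronglyMeasurable)
    (fun m => (integrable_mul_norm_sq_of_le_twistJacobian hκ (c0 m) (hφ m).hasCompactSupport
      (hφ m).tsupport_subset hgm (fun x => (hg0 x).le) fun _ => le_rfl).restrict) m0 l3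
  have t4 := tendsto_integral_mul_norm_sq hwm hw0
    (fun m => (c0 m).aestronglyMeasurable)
    (fun m => (integrable_mul_norm_sq_of_le_twistJacobian hκ (c0 m) (hφ m).hasCompactSupport
      (hφ m).tsupport_subset hwm hw0 (hardyWeight_mul_twistJacobian_le κ)).restrict) m0 l4
  have hle := le_of_tendsto_of_tendsto' ((t4.const_mul c).add (t3.const_mul S.E₁)) (t1.add t2)
    fun m => by
      have := hc (φ m) (cφ m) (hφ m).hasCompactSupport (hφ m).tsupport_subset
      rw [hfull _ _ (hφ m).tsupport_subset, hfull _ _ (hφ m).tsupport_subset,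
        hfull _ _ (sd _ m), hfull _ _ (sd _ m)]
      exact this
  rw [eH, eN, eF]
  exact le_sub_iff_add_le.2 hle

theorem sesqForm_self (ψ : S.HilbertSpace) : S.sesqForm ψ ψ = (S.form ψ : ℂ) := by
  have h : ∀ z : ℂ, star z * z = ((‖z‖ ^ 2 : ℝ) : ℂ) := fun z => by
    rw [Complex.star_def, Complex.conj_mul']
    push_cast
    rfl
  rw [sesqForm, form, Complex.ofReal_add, ← integral_complex_ofReal, ← integral_complex_ofReal]
  simp only [h]
  push_cast
  rfl

end Domain

end Strip

theorem theorem5p1 (n : ℕ) (hn : 0 < n) (S : Strip n) (hS : S.Admissible)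
    (hunbent : S.kΘ =ᵐ[volume] 0)
    (htwisted : ¬ deriv S.Θ =ᵐ[volume] 0)
    (hsmall : ENNReal.ofReal S.a * eLpNorm (deriv S.Θ) ∞ volume ≤ ENNReal.ofReal (√2)) :
    ∃ c : ℝ, 0 < c ∧
      (∀ ψ ∈ S.formDomain,
        c * S.hardyTerm ψ ≤ S.form ψ - S.E₁ * ‖ψ‖ ^ 2) ∧
      (∀ ψ η : S.HilbertSpace, (ψ, η) ∈ S.hamiltonianGraph →
        c * S.hardyTerm ψ ≤ (inner ℂ ψ η).re - S.E₁ * ‖ψ‖ ^ 2) := by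
  obtain ⟨κ, hκm, hκ, hne, hf⟩ :=
    S.exists_f_ae_eq_twistJacobian hS.a_pos hunbent htwisted hsmall
  obtain ⟨c, hc, hφ⟩ := Strip.exists_hardy_test (E := ℂ) hS.a_pos hκm hκ hne
  refine ⟨c, hc, fun ψ hψ => Strip.hardy_formDomain hκm hκ hf hφ hψ, fun ψ η h => ?_⟩
  rw [← h.2 ψ h.1, Strip.sesqForm_self, Complex.ofReal_re]
  exact Strip.hardy_formDomain hκm hκ hf hφ h.1
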